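/- All graphs are finite and simple. For graphs $H$ and $G$, where $G$ has at least one vertex, let $t_H(G)=h_H(G)/|V(G)|^{|V(H)|}$, where $h_H(G)$ is the number of graph homomorphisms from $H$ to $G$, and let $e(H)$ be the number of edges of $H$. We say that $H$ satisfies Sidorenko's conjecture if $t_H(G)\ge t_{K_2}(G)^{e(H)}$ for every graph $G$ with at least one vertex. A bipartite graph $H$ is tree-degenerate if, for some $m\ge 1$, its vertex set $V(H)$ can be partitioned into non-empty blocks $B_0,B_1,\dots,B_m$, and there are sets $P(B_1),\dots,P(B_m)\subseteq V(H)$, such that $P(B_1)=B_0$; for each $2\le i\le m$ there is an index $\gamma(i)$ with $1\le\gamma(i)\le i-1$, $P(B_i)\subseteq B_{\gamma(i)}$ and $|P(B_{\gamma(i)})|\le |P(B_i)|$; and the edges of $H$ are exactly the pairs $xy$ with $x\in P(B_i)$ and $y\in B_i$ for some $1\le i\le m$. **Corollary 1.8.** Every tree-degenerate graph $H$ satisfies Sidorenko's conjecture. This generalizes the Conlon–Fox–Sudakov theorem in the following sense. Let $H$ be a bipartite graph with a bipartition $V(H)=A\sqcup A'$ such that some vertex of $A$ is adjacent to every vertex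 of $A'$. Then $H$ satisfies Sidorenko's conjecture, and if $H$ has no isolated vertices, then $H$ is tree-degenerate. -/

import Mathlib

universe u v

namespace TreeDegenerate

/-- The homomorphism density `t_H(G)`, the number of homomorphisms from `H` to `G` divided by
`|G| ^ |H|`, the number of all maps from the vertices of `H` to those of `G`
(for finite graphs `H` and `G`, with `G` having at least one vertex). -/
noncomputable def homDensity {V : Type u} {W : Type v}
    (H : SimpleGraph V) (G : SimpleGraph W) : ℝ :=
  (Nat.card (H →g G) : ℝ) / (Nat.card W : ℝ) ^ Nat.card V

/-- `H` satisfies Sidorenko's conjecture: `t_H(G) ≥ t_{K_2}(G) ^ e(H)` for every finite graph `G`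
with at least one vertex. The graph `K_2` is the complete graph on `Fin 2`. -/
def SatisfiesSidorenko {V : Type u} (H : SimpleGraph V) : Prop :=
  ∀ (W : Type v) [Finite W] [Nonempty W] (G : SimpleGraph W),
    homDensity (SimpleGraph.completeGraph (Fin 2)) G ^ Nat.card H.edgeSet ≤ homDensity H G

/-- `(B 0, ..., B m, P)` is a block representation of `H`, where `P i` is the parent set of the
non-root block `B i` for `1 ≤ i ≤ m` (the values of `B` and `P` at other indices are irrelevant). -/
structure IsBlockRepresentation {V : Type u} (H : SimpleGraph V) (m : ℕ)
    (B P : ℕ → Finset V) : Prop where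
  /-- there is at least one non-root block -/
  one_le : 1 ≤ m
  /-- the blocks partition the vertex set (into non-empty parts) -/
  nonempty : ∀ i, i ≤ m → (B i).Nonempty
  disjoint : ∀ i j, i ≤ m → j ≤ m → i ≠ j → Disjoint (B i) (B j)
  cover : ∀ x : V, ∃ i, i ≤ m ∧ x ∈ B i
  /-- the parent set of `B 1` is the whole root block -/
  parent_one : P 1 = B 0
  /-- for `i ≥ 2`, the parent set of `B i` lies in an earlier non-root block `B g`, the parent block
  of `B i`, and it is at least as large as the parent set of that block -/
  parent : ∀ i, 2 ≤ i → i ≤ m →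
    ∃ g, 1 ≤ g ∧ g < i ∧ P i ⊆ B g ∧ (P g).card ≤ (P i).card
  /-- the edges of `H` are exactly those that join a non-root block completely to its parent set -/
  adj_iff : ∀ x y : V, H.Adj x y ↔
    ∃ i, 1 ≤ i ∧ i ≤ m ∧ ((x ∈ P i ∧ y ∈ B i) ∨ (y ∈ P i ∧ x ∈ B i))

/-- A tree-degenerate graph: a bipartite graph that has a block representation. -/
def IsTreeDegenerate {V : Type u} (H : SimpleGraph V) : Prop :=
  H.IsBipartite ∧ ∃ (m : ℕ) (B P : ℕ → Finset V), IsBlockRepresentation H m B P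

/-- `H` is bipartite with parts `A` and `Aᶜ`, and some vertex of `A` is adjacent to every vertex of
the other part `Aᶜ`. -/
def HasVertexCompleteToOtherPart {V : Type u} (H : SimpleGraph V) : Prop :=
  ∃ A : Set V, H.IsBipartiteWith A Aᶜ ∧ ∃ a ∈ A, ∀ b ∉ A, H.Adj a b

end TreeDegenerate

/-!
The proof is by the entropy method. For a random map `X` from the vertices of `H` to those of `G`
that is almost surely a homomorphism, the entropy of `X` is at most the logarithm of the number of
homomorphisms (`entropy_le_log_card`), so a random homomorphism of large entropy is needed.

Let `n = |G|`, let `E` be the entropy of a uniformly random directed edge of `G`, let `h ≤ log n` be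
the entropy of one of its ends, and `c = E - 2 h ≤ 0`. The random homomorphism is built vertex by
vertex. Its basic step (`exists_copies`) replaces the variable at a vertex by a copy of an earlier
variable `X j` that is conditionally independent of all others given the variables in a set `P`; the
entropy then grows by the conditional entropy of `X j` given `P`. A random edge yields a star, the
star yields the complete bipartite graph on `B 0` and `B 1`, and a later block `B i` consists of
copies, given `P i`, of the vertex `j` of `P g` with the largest conditional entropy, where `B g` is
the parent block. Such a copy is adjacent to all of `P i`, as `j` is adjacent to all of `B g`.

The invariant `IsBlockDistribution` says that every new vertex of `B i` has conditional entropy at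
least `h + a c + (h - H(P i) / a)` with `a = |P i|`. It is inherited from the parent block by
subadditivity of conditional entropy (`entropy_union_sub_le_sum`) and the monotonicity of the sizes
of parent sets (`le_conditional_entropy`). Since `H(P i) ≤ a h`, adding up gives a homomorphism of
entropy at least `|H| h + e(H) c = e(H) E - (2 e(H) - |H|) h`. As `H` has no isolated vertices,
`|H| ≤ 2 e(H)`, so that `h ≤ log n` gives the Sidorenko bound.

If some vertex is complete to the other part and no vertex is isolated, then the remaining
vertices of its own part, as singleton blocks, give a block representation; isolated vertices affect
neither side of the Sidorenko inequality (`SatisfiesSidorenko.of_induce_support`).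
-/

namespace TreeDegenerate

open Finset

/-! ### Shannon entropy on finite probability spaces -/

section Entropy

variable {V W Ω : Type*}

/-- The outcomes `ω` and `ω'` give the same value to each of the random variables `X s`, `s ∈ S`. -/
def Agree (X : V → Ω → W) (S : Finset V) (ω ω' : Ω) : Prop :=
  ∀ s ∈ S, X s ω = X s ω'

lemma Agree.refl (X : V → Ω → W) (S : Finset V) (ω : Ω) : Agree X S ω ω := fun _ _ => rfl

lemma Agree.symm {X : V → Ω → W} {S : Finset V} {ω ω' : Ω} (h : Agree X S ω ω') :
    Agree X S ω' ω := fun s hs => (h s hs).symm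

lemma Agree.trans {X : V → Ω → W} {S : Finset V} {ω ω' ω'' : Ω} (h : Agree X S ω ω')
    (h' : Agree X S ω' ω'') : Agree X S ω ω'' := fun s hs => (h s hs).trans (h' s hs)

lemma Agree.mono {X : V → Ω → W} {S T : Finset V} {ω ω' : Ω} (hST : S ⊆ T)
    (h : Agree X T ω ω') : Agree X S ω ω' := fun s hs => h s (hST hs)

lemma agree_union [DecidableEq V] {X : V → Ω → W} {S T : Finset V} {ω ω' : Ω} :
    Agree X (S ∪ T) ω ω' ↔ Agree X S ω ω' ∧ Agree X T ω ω' :=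
  ⟨fun h => ⟨h.mono subset_union_left, h.mono subset_union_right⟩, fun h s hs =>
    (mem_union.1 hs).elim (h.1 s) (h.2 s)⟩

lemma agree_insert [DecidableEq V] {X : V → Ω → W} {S : Finset V} {v : V} {ω ω' : Ω} :
    Agree X (insert v S) ω ω' ↔ X v ω = X v ω' ∧ Agree X S ω ω' := by
  simp [Agree]

/-- `p` is a probability distribution on the finite type `Ω`. -/
structure IsDistribution [Fintype Ω] (p : Ω → ℝ) : Prop where
  nonneg : ∀ ω, 0 ≤ p ω
  sum_eq_one : ∑ ω, p ω = 1

open scoped Classical in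
/-- The marginal of `p` on the variables `X s`, `s ∈ S`, regarded as a function of the outcome: the
probability that these variables take the values that they have at `ω`. -/
noncomputable def marginal [Fintype Ω] (p : Ω → ℝ) (X : V → Ω → W) (S : Finset V) (ω : Ω) : ℝ :=
  ∑ ω', if Agree X S ω ω' then p ω' else 0

/-- The joint Shannon entropy (with natural logarithms) of the variables `X s`, `s ∈ S`, as the
expectation of minus the logarithm of their marginal. -/
noncomputable def entropy [Fintype Ω] (p : Ω → ℝ) (X : V → Ω → W) (S : Finset V) : ℝ :=
  -∑ ω, p ω * Real.log (marginal p X S ω)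

variable [Fintype Ω] {p : Ω → ℝ} {X : V → Ω → W}

lemma marginal_congr {S : Finset V} {ω ω' : Ω} (h : Agree X S ω ω') :
    marginal p X S ω = marginal p X S ω' := by
  classical
  refine sum_congr rfl fun η _ => if_congr ⟨h.symm.trans, h.trans⟩ rfl rfl

lemma le_marginal (hp : IsDistribution p) (S : Finset V) (ω : Ω) : p ω ≤ marginal p X S ω := by
  classical
  have := single_le_sum (f := fun ω' => if Agree X S ω ω' then p ω' else 0)
    (fun ω' _ => by split_ifs; exacts [hp.nonneg _, le_rfl]) (mem_univ ω)
  simpa [Agree.refl, marginal] using this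

lemma marginal_nonneg (hp : IsDistribution p) (S : Finset V) (ω : Ω) :
    0 ≤ marginal p X S ω := (hp.nonneg ω).trans (le_marginal hp S ω)

lemma marginal_pos (hp : IsDistribution p) (S : Finset V) {ω : Ω} (h : p ω ≠ 0) :
    0 < marginal p X S ω :=
  ((hp.nonneg ω).lt_of_ne' h).trans_le (le_marginal hp S ω)

lemma entropy_empty (hp : IsDistribution p) : entropy p X ∅ = 0 := by
  simp [entropy, marginal, Agree, hp.sum_eq_one]

/-- Entropy is at most the logarithm of the number of values, by the inequality
`log t ≤ t - 1` at `t = 1 / (marginal * number of values)`. -/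
lemma entropy_le_log_card (hp : IsDistribution p) {τ : Type*} (T : Finset τ) (F : Ω → τ)
    (S : Finset V) (hF : ∀ ω, p ω ≠ 0 → F ω ∈ T) (hS : ∀ ω ω', F ω = F ω' → Agree X S ω ω') :
    entropy p X S ≤ Real.log #T := by
  classical
  have hT : (0 : ℝ) < #T := by
    obtain ⟨ω, -, hω⟩ := exists_ne_zero_of_sum_ne_zero (hp.sum_eq_one.trans_ne one_ne_zero)
    exact_mod_cast card_pos.2 ⟨_, hF ω hω⟩
  have hsum : ∑ ω, p ω / marginal p X S ω ≤ #T := by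
    have h1 : ∑ ω, p ω / marginal p X S ω
        = ∑ ω with p ω ≠ 0, p ω / marginal p X S ω := by
      rw [sum_filter_of_ne]
      intro ω _ h h0
      simp [h0] at h
    rw [h1, ← sum_fiberwise_of_maps_to (s := univ.filter fun ω => p ω ≠ 0) (t := T) (g := F)
      (by simpa using hF), card_eq_sum_ones, Nat.cast_sum]
    refine sum_le_sum fun t _ => ?_
    by_cases hne : ∃ ω, p ω ≠ 0 ∧ F ω = t
    · obtain ⟨ω, hω, rfl⟩ := hne
      have h2 : ∀ η ∈ {η ∈ ({η | p η ≠ 0} : Finset Ω) | F η = F ω},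
          p η / marginal p X S η = p η / marginal p X S ω := fun η hη => by
        rw [marginal_congr (hS η ω (mem_filter.1 hη).2)]
      rw [sum_congr rfl h2, ← sum_div, Nat.cast_one, div_le_one (marginal_pos hp S hω), marginal,
        ← sum_filter]
      refine sum_le_sum_of_subset_of_nonneg (fun η hη => ?_) fun η _ _ => hp.nonneg η
      simpa using hS ω η (mem_filter.1 hη).2.symm
    · rw [sum_eq_zero]
      · simp
      · intro η hη
        simp only [mem_filter, mem_univ, true_and] at hη
        exact (hne ⟨η, hη⟩).elim
  have key : ∀ ω, p ω * (-Real.log (marginal p X S ω) - Real.log #T)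
      ≤ (p ω / marginal p X S ω) / #T - p ω := by
    intro ω
    by_cases h : p ω = 0
    · simp [h]
    · have hm := marginal_pos (X := X) hp S h
      have := Real.log_le_sub_one_of_pos (x := (marginal p X S ω * #T)⁻¹) (by positivity)
      rw [Real.log_inv, Real.log_mul hm.ne' hT.ne'] at this
      calc _ = p ω * -(Real.log (marginal p X S ω) + Real.log #T) := by ring
        _ ≤ p ω * ((marginal p X S ω * #T)⁻¹ - 1) :=
          mul_le_mul_of_nonneg_left this (hp.nonneg ω)
        _ = _ := by field_simp
  have := sum_le_sum fun ω (_ : ω ∈ univ) => key ω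
  simp only [mul_sub, mul_neg, sum_sub_distrib, ← sum_mul, sum_neg_distrib, ← sum_div,
    hp.sum_eq_one] at this
  have h3 : (∑ ω, p ω / marginal p X S ω) / #T ≤ 1 := (div_le_one hT).2 hsum
  unfold entropy
  linarith

/-- Submodularity of entropy, from `log t ≤ t - 1` at the ratio of the two products of
marginals. -/
lemma entropy_union_add_inter [DecidableEq V] (hp : IsDistribution p) (A B : Finset V) :
    entropy p X (A ∪ B) + entropy p X (A ∩ B) ≤ entropy p X A + entropy p X B := by
  classical
  set mA := marginal p X A
  set mB := marginal p X B
  set mU := marginal p X (A ∪ B) with hmU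
  set mI := marginal p X (A ∩ B) with hmI
  have hI0 : ∀ ω, 0 ≤ mI ω := marginal_nonneg hp _
  -- For fixed `ω₁`, `ω₂`, the `ω` in the inner sum all agree on `A ∪ B`, so that their weights
  -- add up to at most one.
  have inner : ∀ ω₁ ω₂, ∑ ω, (if Agree X A ω ω₁ ∧ Agree X B ω ω₂ then p ω / (mU ω * mI ω) else 0)
      ≤ if Agree X (A ∩ B) ω₁ ω₂ then (mI ω₁)⁻¹ else 0 := by
    intro ω₁ ω₂
    by_cases hne : ∃ ω, p ω ≠ 0 ∧ Agree X A ω ω₁ ∧ Agree X B ω ω₂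
    · obtain ⟨ω, hω, hA, hB⟩ := hne
      rw [if_pos ((hA.symm.mono inter_subset_left).trans (hB.mono inter_subset_right)),
        hmI, ← marginal_congr (hA.mono inter_subset_left), ← hmI]
      have hU : 0 < mU ω := marginal_pos hp _ hω
      calc _ ≤ ∑ η, (if Agree X (A ∪ B) ω η then p η else 0) / (mU ω * mI ω) := by
            refine sum_le_sum fun η _ => ?_
            by_cases h : Agree X A η ω₁ ∧ Agree X B η ω₂
            · have hη : Agree X (A ∪ B) ω η :=
                agree_union.2 ⟨hA.trans h.1.symm, hB.trans h.2.symm⟩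
              rw [if_pos h, if_pos hη, hmU, hmI, marginal_congr hη,
                marginal_congr (hη.mono (inter_subset_left.trans subset_union_left))]
            · rw [if_neg h]
              refine div_nonneg ?_ (mul_nonneg hU.le (hI0 ω))
              split_ifs; exacts [hp.nonneg _, le_rfl]
        _ = (mI ω)⁻¹ := by
            rw [← sum_div]
            change mU ω / _ = _
            rw [div_mul_eq_div_div, div_self hU.ne', one_div]
    · rw [sum_eq_zero]
      · split_ifs; exacts [inv_nonneg.2 (hI0 _), le_rfl]
      · intro ω _
        split_ifs with h
        · by_cases h0 : p ω = 0
          · simp [h0]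
          · exact (hne ⟨ω, h0, h⟩).elim
        · rfl
  have hsum : ∑ ω, p ω * (mA ω * mB ω / (mU ω * mI ω)) ≤ 1 := by
    calc ∑ ω, p ω * (mA ω * mB ω / (mU ω * mI ω))
        = ∑ ω, ∑ ω₁, ∑ ω₂, p ω₁ * p ω₂ *
          (if Agree X A ω ω₁ ∧ Agree X B ω ω₂ then p ω / (mU ω * mI ω) else 0) := by
          refine sum_congr rfl fun ω _ => ?_
          rw [show p ω * (mA ω * mB ω / (mU ω * mI ω)) = mA ω * mB ω * (p ω / (mU ω * mI ω)) by
            ring]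
          change (∑ ω₁, _) * (∑ ω₂, _) * _ = _
          rw [sum_mul_sum, sum_mul]
          refine sum_congr rfl fun ω₁ _ => ?_
          rw [sum_mul]
          refine sum_congr rfl fun ω₂ _ => ?_
          by_cases h1 : Agree X A ω ω₁ <;> by_cases h2 : Agree X B ω ω₂ <;> simp [h1, h2]
      _ = ∑ ω₁, ∑ ω₂, p ω₁ * p ω₂ *
          ∑ ω, (if Agree X A ω ω₁ ∧ Agree X B ω ω₂ then p ω / (mU ω * mI ω) else 0) := by
          rw [sum_comm]
          refine sum_congr rfl fun ω₁ _ => ?_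
          rw [sum_comm]
          simp only [mul_sum]
      _ ≤ ∑ ω₁, ∑ ω₂, p ω₁ * p ω₂ * (if Agree X (A ∩ B) ω₁ ω₂ then (mI ω₁)⁻¹ else 0) :=
          sum_le_sum fun ω₁ _ => sum_le_sum fun ω₂ _ =>
            mul_le_mul_of_nonneg_left (inner ω₁ ω₂) (mul_nonneg (hp.nonneg _) (hp.nonneg _))
      _ = ∑ ω₁, p ω₁ * (mI ω₁ * (mI ω₁)⁻¹) := by
          refine sum_congr rfl fun ω₁ _ => ?_
          rw [hmI]
          conv_rhs => rw [marginal, sum_mul, mul_sum]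
          refine sum_congr rfl fun ω₂ _ => ?_
          split_ifs <;> simp [mul_assoc, marginal]
      _ ≤ ∑ ω₁, p ω₁ :=
          sum_le_sum fun ω₁ _ => mul_le_of_le_one_right (hp.nonneg _) mul_inv_le_one
      _ = 1 := hp.sum_eq_one
  have key : ∀ ω, p ω * (Real.log (mA ω) + Real.log (mB ω) - Real.log (mU ω) - Real.log (mI ω))
      ≤ p ω * (mA ω * mB ω / (mU ω * mI ω)) - p ω := by
    intro ω
    by_cases h : p ω = 0
    · simp [h]
    · have hA : 0 < mA ω := marginal_pos hp _ h
      have hB : 0 < mB ω := marginal_pos hp _ h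
      have hU : 0 < mU ω := marginal_pos hp _ h
      have hI : 0 < mI ω := marginal_pos hp _ h
      have := Real.log_le_sub_one_of_pos (x := mA ω * mB ω / (mU ω * mI ω)) (by positivity)
      rw [Real.log_div (by positivity) (by positivity), Real.log_mul hA.ne' hB.ne',
        Real.log_mul hU.ne' hI.ne'] at this
      rw [← mul_sub_one]
      exact mul_le_mul_of_nonneg_left (by linarith) (hp.nonneg ω)
  have := sum_le_sum fun ω (_ : ω ∈ univ) => key ω
  simp only [mul_sub, mul_add, sum_sub_distrib, sum_add_distrib, hp.sum_eq_one] at this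
  unfold entropy
  linarith

/-- Subadditivity of conditional entropy: given the variables in `A`, the entropy of the variables
in `S` is at most the sum of their individual entropies. -/
lemma entropy_union_sub_le_sum [DecidableEq V] (hp : IsDistribution p) (A S : Finset V) :
    entropy p X (A ∪ S) - entropy p X A
      ≤ ∑ v ∈ S, (entropy p X (insert v A) - entropy p X A) := by
  induction S using Finset.induction_on with
  | empty => simp
  | insert v S hv ih =>
    rw [sum_insert hv]
    by_cases hvA : v ∈ A
    · rw [union_insert, insert_eq_of_mem (mem_union_left _ hvA), insert_eq_of_mem hvA]
      linarith
    · have h := entropy_union_add_inter (X := X) hp (A ∪ S) (insert v A)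
      have h1 : (A ∪ S) ∪ insert v A = A ∪ insert v S := by grind
      have h2 : (A ∪ S) ∩ insert v A = A := by grind
      rw [h1, h2] at h
      linarith

lemma entropy_le_sum [DecidableEq V] (hp : IsDistribution p) (S : Finset V) :
    entropy p X S ≤ ∑ v ∈ S, entropy p X {v} := by
  simpa [entropy_empty hp] using entropy_union_sub_le_sum (X := X) hp ∅ S

end Entropy

/-! ### Conditionally independent copies -/

section Copies

variable {V W Ω : Type*}

/-- Variables on pairs of outcomes: all variables are read off the first outcome, except that the
variable at `v` is replaced by the variable at `j` of the second outcome. -/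
def copyVar [DecidableEq V] (X : V → Ω → W) (j v : V) : V → Ω × Ω → W :=
  fun u ω => if u = v then X j ω.2 else X u ω.1

lemma agree_copyVar [DecidableEq V] {X : V → Ω → W} {j v : V} {S : Finset V}
    (hv : v ∉ S) {ω ω' : Ω × Ω} :
    Agree (copyVar X j v) S ω ω' ↔ Agree X S ω.1 ω'.1 := by
  refine forall₂_congr fun s hs => ?_
  have : s ≠ v := fun h => hv (h ▸ hs)
  simp [copyVar, this]

variable [Fintype Ω]

open scoped Classical in
/-- The coupling of two copies of `p` that agree on the variables in `P` and are conditionally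
independent given these. -/
noncomputable def coupling (p : Ω → ℝ) (X : V → Ω → W) (P : Finset V) (ω : Ω × Ω) : ℝ :=
  if Agree X P ω.1 ω.2 then p ω.1 * p ω.2 / marginal p X P ω.1 else 0

variable {p : Ω → ℝ} {X : V → Ω → W}

lemma coupling_swap (P : Finset V) (ω ω' : Ω) :
    coupling p X P (ω, ω') = coupling p X P (ω', ω) := by
  classical
  by_cases h : Agree X P ω ω'
  · simp only [coupling, if_pos h, if_pos h.symm, marginal_congr h, mul_comm (p ω)]
  · simp only [coupling, if_neg h, if_neg fun h' => h (Agree.symm h')]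

lemma sum_coupling_right (hp : IsDistribution p) (P : Finset V) (ω : Ω) :
    ∑ ω', coupling p X P (ω, ω') = p ω := by
  classical
  by_cases h : p ω = 0
  · simp [coupling, h]
  · calc _ = ∑ ω', (if Agree X P ω ω' then p ω' else 0) * (p ω / marginal p X P ω) := by
          refine sum_congr rfl fun ω' _ => ?_
          simp only [coupling]
          split_ifs
          · ring
          · simp
      _ = marginal p X P ω * (p ω / marginal p X P ω) := by rw [← sum_mul]; rfl
      _ = p ω := mul_div_cancel₀ _ (marginal_pos hp P h).ne'

lemma sum_coupling_left (hp : IsDistribution p) (P : Finset V) (ω' : Ω) :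
    ∑ ω, coupling p X P (ω, ω') = p ω' := by
  simp_rw [coupling_swap P _ ω', sum_coupling_right hp]

lemma sum_coupling_mul_fst (hp : IsDistribution p) (P : Finset V) (F : Ω → ℝ) :
    ∑ ω, coupling p X P ω * F ω.1 = ∑ ω, p ω * F ω := by
  simp only [Fintype.sum_prod_type, ← sum_mul, sum_coupling_right hp]

lemma sum_coupling_mul_snd (hp : IsDistribution p) (P : Finset V) (F : Ω → ℝ) :
    ∑ ω, coupling p X P ω * F ω.2 = ∑ ω, p ω * F ω := by
  simp only [Fintype.sum_prod_type_right, ← sum_mul, sum_coupling_left hp]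

lemma isDistribution_coupling (hp : IsDistribution p) (P : Finset V) :
    IsDistribution (coupling p X P) where
  nonneg ω := by
    classical
    unfold coupling
    split_ifs
    exacts [div_nonneg (mul_nonneg (hp.nonneg _) (hp.nonneg _)) (marginal_nonneg hp _ _), le_rfl]
  sum_eq_one := by
    simpa [hp.sum_eq_one] using sum_coupling_mul_fst (X := X) hp P fun _ => 1

lemma ne_zero_of_coupling_ne_zero {P : Finset V} {ω : Ω × Ω} (h : coupling p X P ω ≠ 0) :
    p ω.1 ≠ 0 ∧ p ω.2 ≠ 0 ∧ Agree X P ω.1 ω.2 := by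
  classical
  by_cases hA : Agree X P ω.1 ω.2
  · refine ⟨fun h0 => h ?_, fun h0 => h ?_, hA⟩ <;> simp [coupling, h0]
  · exact (h (by simp [coupling, hA])).elim

variable [DecidableEq V] {j v : V}

lemma marginal_coupling (hp : IsDistribution p) (P : Finset V) {S : Finset V} (hv : v ∉ S)
    (ω : Ω × Ω) :
    marginal (coupling p X P) (copyVar X j v) S ω = marginal p X S ω.1 := by
  classical
  unfold marginal
  simp only [agree_copyVar hv]
  simpa using sum_coupling_mul_fst (X := X) hp P fun ω' => if Agree X S ω.1 ω' then 1 else 0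

lemma entropy_coupling (hp : IsDistribution p) (P : Finset V) {S : Finset V} (hv : v ∉ S) :
    entropy (coupling p X P) (copyVar X j v) S = entropy p X S := by
  simp only [entropy, marginal_coupling hp P hv]
  rw [sum_coupling_mul_fst hp P fun ω => Real.log (marginal p X S ω)]

lemma entropy_coupling_singleton (hp : IsDistribution p) (P : Finset V) :
    entropy (coupling p X P) (copyVar X j v) {v} = entropy p X {j} := by
  classical
  have hm : ∀ ω, marginal (coupling p X P) (copyVar X j v) {v} ω = marginal p X {j} ω.2 := by
    intro ω
    have := sum_coupling_mul_snd (X := X) hp P fun ω' => if Agree X {j} ω.2 ω' then 1 else 0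
    simpa [marginal, Agree, copyVar] using this
  simp only [entropy, hm]
  rw [sum_coupling_mul_snd hp P fun ω => Real.log (marginal p X {j} ω)]

/-- Given `P`, the new variable is independent of all old ones, and its conditional entropy
is that of the variable it copies. -/
lemma entropy_coupling_insert (hp : IsDistribution p) {P S : Finset V} (hPS : P ⊆ S)
    (hv : v ∉ S) :
    entropy (coupling p X P) (copyVar X j v) (insert v S)
      = entropy p X S + (entropy p X (insert j P) - entropy p X P) := by
  classical
  have hm : ∀ ω, coupling p X P ω ≠ 0 →
      marginal (coupling p X P) (copyVar X j v) (insert v S) ω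
        = marginal p X S ω.1 * marginal p X (insert j P) ω.2 / marginal p X P ω.1 := by
    intro ω hω
    obtain ⟨-, -, hP⟩ := ne_zero_of_coupling_ne_zero hω
    simp only [marginal, Fintype.sum_prod_type]
    rw [sum_mul_sum, sum_div]
    refine sum_congr rfl fun ω₁ _ => ?_
    rw [sum_div]
    refine sum_congr rfl fun ω₂ _ => ?_
    by_cases h1 : Agree X S ω.1 ω₁
    · have hcongr : (X j ω.2 = X j ω₂ ∧ Agree X P ω₁ ω₂) ↔ Agree X (insert j P) ω.2 ω₂ := by
        rw [agree_insert]
        refine and_congr_right fun _ => ?_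
        exact ⟨(hP.symm.trans (h1.mono hPS)).trans, (hP.symm.trans (h1.mono hPS)).symm.trans⟩
      simp only [agree_insert, agree_copyVar hv, coupling, h1, ← hcongr]
      rw [← marginal_congr (h1.mono hPS)]
      by_cases h2 : X j ω.2 = X j ω₂ <;> by_cases h3 : Agree X P ω₁ ω₂ <;>
        simp [copyVar, h2, h3, marginal]
    · simp [agree_insert, agree_copyVar hv, h1]
  have hlog : ∀ ω, coupling p X P ω *
        Real.log (marginal (coupling p X P) (copyVar X j v) (insert v S) ω)
      = coupling p X P ω * Real.log (marginal p X S ω.1)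
        + coupling p X P ω * Real.log (marginal p X (insert j P) ω.2)
        - coupling p X P ω * Real.log (marginal p X P ω.1) := by
    intro ω
    by_cases hω : coupling p X P ω = 0
    · simp [hω]
    · obtain ⟨h1, h2, -⟩ := ne_zero_of_coupling_ne_zero hω
      have hS := marginal_pos (X := X) hp S h1
      have hP := marginal_pos (X := X) hp P h1
      have hj := marginal_pos (X := X) hp (insert j P) h2
      rw [hm ω hω, Real.log_div (by positivity) hP.ne', Real.log_mul hS.ne' hj.ne']
      ring
  simp only [entropy, hlog, sum_sub_distrib, sum_add_distrib]
  rw [sum_coupling_mul_fst hp P fun ω => Real.log (marginal p X S ω),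
    sum_coupling_mul_snd hp P fun ω => Real.log (marginal p X (insert j P) ω),
    sum_coupling_mul_fst hp P fun ω => Real.log (marginal p X P ω)]
  ring

end Copies

/-- The variables at the vertices of `T` can be replaced by copies of the variable at `j` that are
conditionally independent given those in `P`, of each other and of the rest. -/
lemma exists_copies {V W : Type*} [DecidableEq V] {Ω : Type v} [Fintype Ω] {p : Ω → ℝ}
    {X : V → Ω → W} (hp : IsDistribution p) {P : Finset V} {j : V} (T : Finset V)
    (hPT : Disjoint P T) (hj : j ∉ T) :
    ∃ (Ω' : Type v) (_ : Fintype Ω') (p' : Ω' → ℝ) (X' : V → Ω' → W), IsDistribution p' ∧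
      (∀ S, Disjoint S T → entropy p' X' S = entropy p X S) ∧
      (∀ v ∈ T, entropy p' X' {v} = entropy p X {j}) ∧
      (∀ S R, P ⊆ S → Disjoint S T → R ⊆ T → entropy p' X' (S ∪ R)
        = entropy p X S + #R * (entropy p X (insert j P) - entropy p X P)) ∧
      (∀ ω', p' ω' ≠ 0 → (∃ ω, p ω ≠ 0 ∧ ∀ u ∉ T, X' u ω' = X u ω) ∧
        ∀ v ∈ T, ∃ ω, p ω ≠ 0 ∧ (∀ u ∈ P, X' u ω' = X u ω) ∧ X' v ω' = X j ω) := by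
  induction T using Finset.induction_on with
  | empty =>
    refine ⟨Ω, inferInstance, p, X, hp, by simp, by simp, fun S R _ _ hR => ?_,
      fun ω hω => ⟨⟨ω, hω, by simp⟩, by simp⟩⟩
    simp [subset_empty.1 hR]
  | insert v T hv ih =>
    rw [disjoint_insert_right] at hPT
    rw [mem_insert, not_or] at hj
    obtain ⟨Ω', _, p', X', hp', h1, h2, h3, h4⟩ := ih hPT.2 hj.2
    refine ⟨Ω' × Ω', inferInstance, coupling p' X' P, copyVar X' j v,
      isDistribution_coupling hp' P, ?_, ?_, ?_, ?_⟩
    · intro S hS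
      rw [disjoint_insert_right] at hS
      rw [entropy_coupling hp' P hS.1, h1 S hS.2]
    · intro u hu
      rcases mem_insert.1 hu with rfl | hu
      · rw [entropy_coupling_singleton hp', h1 _ (by simpa using hj.2)]
      · rw [entropy_coupling hp' P (by simpa using fun h : v = u => hv (h ▸ hu)), h2 u hu]
    · intro S R hPS hST hR
      rw [disjoint_insert_right] at hST
      by_cases hvR : v ∈ R
      · have hR' : R.erase v ⊆ T := by rwa [← subset_insert_iff]
        have hvS : v ∉ S ∪ R.erase v := by simp [hST.1]
        rw [← insert_erase hvR, union_insert,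
          entropy_coupling_insert hp' (hPS.trans subset_union_left) hvS, h3 S _ hPS hST.2 hR',
          card_insert_of_notMem (notMem_erase v R), h1 P hPT.2,
          h1 (insert j P) (disjoint_insert_left.2 ⟨hj.2, hPT.2⟩)]
        push_cast
        ring
      · rw [entropy_coupling hp' P (by simp [hST.1, hvR]),
          h3 S R hPS hST.2 ((subset_insert_iff_of_notMem hvR).1 hR)]
    · intro ω hω
      obtain ⟨ha, hb, hab⟩ := ne_zero_of_coupling_ne_zero hω
      obtain ⟨⟨η, hη, hη'⟩, h5⟩ := h4 ω.1 ha
      have hPv : ∀ u ∈ P, copyVar X' j v u ω = X' u ω.1 := fun u hu => by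
        simp [copyVar, show u ≠ v from fun h => hPT.1 (h ▸ hu)]
      refine ⟨⟨η, hη, fun u hu => ?_⟩, fun u hu => ?_⟩
      · rw [mem_insert, not_or] at hu
        simpa [copyVar, hu.1] using hη' u hu.2
      · by_cases huv : u = v
        · obtain ⟨⟨ζ, hζ, hζ'⟩, -⟩ := h4 ω.2 hb
          refine ⟨ζ, hζ, fun w hw => ?_, ?_⟩
          · rw [hPv w hw, hab w hw, hζ' w (disjoint_left.1 hPT.2 hw)]
          · simp [copyVar, huv, hζ' j hj.2]
        · obtain ⟨ζ, hζ, hζ', hζj⟩ := h5 u (mem_of_mem_insert_of_ne hu huv)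
          exact ⟨ζ, hζ, fun w hw => (hPv w hw).trans (hζ' w hw), by simpa [copyVar, huv] using hζj⟩

/-! ### Combinatorics of block representations -/

namespace IsBlockRepresentation

variable {V : Type u} {H : SimpleGraph V} {m : ℕ} {B P : ℕ → Finset V}

lemma exists_parent_subset (hB : IsBlockRepresentation H m B P) {i : ℕ} (h1 : 1 ≤ i)
    (hi : i ≤ m) : ∃ g < i, P i ⊆ B g := by
  rcases h1.eq_or_lt with rfl | h2
  · exact ⟨0, by simp, hB.parent_one.subset⟩
  · obtain ⟨g, -, hg, hP, -⟩ := hB.parent i h2 hi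
    exact ⟨g, hg, hP⟩

lemma card_parent_pos (hB : IsBlockRepresentation H m B P) {i : ℕ} (h1 : 1 ≤ i) (hi : i ≤ m) :
    0 < #(P i) := by
  induction i using Nat.strong_induction_on with
  | _ i ih =>
    rcases h1.eq_or_lt with rfl | h2
    · rw [hB.parent_one]
      exact card_pos.2 (hB.nonempty 0 (Nat.zero_le _))
    · obtain ⟨g, hg1, hg, -, hc⟩ := hB.parent i h2 hi
      exact (ih g hg hg1 (hg.le.trans hi)).trans_le hc

lemma disjoint_parent (hB : IsBlockRepresentation H m B P) {i j : ℕ} (h1 : 1 ≤ i) (hij : i ≤ j)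
    (hj : j ≤ m) : Disjoint (P i) (B j) := by
  obtain ⟨g, hg, hP⟩ := hB.exists_parent_subset h1 (hij.trans hj)
  exact (hB.disjoint g j (by omega) hj (by omega)).mono_left hP

/-- The edges between the blocks and their parent sets are pairwise distinct. -/
lemma sum_card_mul_card_le [Finite V] (hB : IsBlockRepresentation H m B P) :
    ∑ k ∈ Icc 1 m, #(P k) * #(B k) ≤ Nat.card H.edgeSet := by
  classical
  have := Fintype.ofFinite V
  rw [Nat.card_eq_fintype_card, ← SimpleGraph.edgeFinset_card]
  have hdisj : ∀ k ∈ Icc 1 m, ∀ l ∈ Icc 1 m, k ≠ l → Disjoint (P k ×ˢ B k) (P l ×ˢ B l) := by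
    intro k hk l hl hkl
    exact disjoint_product.2
      (Or.inr (hB.disjoint k l (mem_Icc.1 hk).2 (mem_Icc.1 hl).2 hkl))
  have hcard : #((Icc 1 m).biUnion fun k => P k ×ˢ B k) = ∑ k ∈ Icc 1 m, #(P k) * #(B k) := by
    rw [card_biUnion hdisj]
    simp
  rw [← hcard]
  have hmem : ∀ e ∈ (Icc 1 m).biUnion fun k => P k ×ˢ B k,
      ∃ k, 1 ≤ k ∧ k ≤ m ∧ e.1 ∈ P k ∧ e.2 ∈ B k := by
    intro e he
    simpa [and_assoc] using he
  refine card_le_card_of_injOn (fun e => s(e.1, e.2)) (fun e he => ?_) fun e he e' he' hee => ?_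
  · obtain ⟨k, h1, hk, hu, hv⟩ := hmem e he
    simpa using (hB.adj_iff e.1 e.2).2 ⟨k, h1, hk, Or.inl ⟨hu, hv⟩⟩
  · obtain ⟨k, hk1, hk, hu, hv⟩ := hmem e he
    obtain ⟨l, hl1, hl, hu', hv'⟩ := hmem e' he'
    rcases Sym2.eq_iff.1 hee with ⟨h, h'⟩ | ⟨h, h'⟩
    · exact Prod.ext h h'
    -- A parent set precedes its block, so no edge occurs in both orientations.
    · exfalso
      rcases le_total k l with hkl | hkl
      · exact disjoint_left.1 (hB.disjoint_parent hk1 hkl hl) hu (h ▸ hv')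
      · exact disjoint_left.1 (hB.disjoint_parent hl1 hkl hk) hu' (h' ▸ hv)

lemma exists_adj (hB : IsBlockRepresentation H m B P) (x : V) : ∃ y, H.Adj x y := by
  obtain ⟨i, hi, hx⟩ := hB.cover x
  rcases Nat.eq_zero_or_pos i with rfl | h1
  · obtain ⟨y, hy⟩ := hB.nonempty 1 hB.one_le
    exact ⟨y, (hB.adj_iff x y).2 ⟨1, le_rfl, hB.one_le, Or.inl ⟨by rwa [hB.parent_one], hy⟩⟩⟩
  · obtain ⟨y, hy⟩ := card_pos.1 (hB.card_parent_pos h1 hi)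
    exact ⟨y, (hB.adj_iff x y).2 ⟨i, h1, hi, Or.inr ⟨hy, hx⟩⟩⟩

lemma card_le_two_mul_card_edgeSet [Finite V] (hB : IsBlockRepresentation H m B P) :
    Nat.card V ≤ 2 * Nat.card H.edgeSet := by
  classical
  have := Fintype.ofFinite V
  rw [Nat.card_eq_fintype_card, Nat.card_eq_fintype_card, ← SimpleGraph.edgeFinset_card,
    ← H.sum_degrees_eq_twice_card_edges, ← card_univ, card_eq_sum_ones]
  exact sum_le_sum fun x _ => (H.degree_pos_iff_exists_adj x).2 (hB.exists_adj x)

end IsBlockRepresentation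

/-! ### Random homomorphisms from tree-degenerate graphs -/

/-- A uniformly random directed edge of `G`, placed at the vertices `x` and `y`. -/
lemma exists_edge_distribution {V : Type u} [DecidableEq V] {W : Type v} [Finite W]
    (G : SimpleGraph W) [Nonempty G.Dart] {x y : V} (hxy : x ≠ y) :
    ∃ (Ω : Type v) (_ : Fintype Ω) (p : Ω → ℝ) (X : V → Ω → W), IsDistribution p ∧
      entropy p X {y} = entropy p X {x} ∧ entropy p X {x, y} = Real.log (Nat.card G.Dart) ∧
      entropy p X {x} ≤ Real.log (Nat.card W) ∧ ∀ ω, G.Adj (X x ω) (X y ω) := by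
  classical
  have := Fintype.ofFinite W
  let p : G.Dart → ℝ := fun _ => (Fintype.card G.Dart : ℝ)⁻¹
  let X : V → G.Dart → W := fun u d => if u = x then d.fst else d.snd
  have hp : IsDistribution p := ⟨fun _ => by positivity, by simp [p]⟩
  refine ⟨G.Dart, inferInstance, p, X, hp, ?_, ?_, ?_, fun d => by simp [X, hxy.symm, d.adj]⟩
  · have hm : ∀ d : G.Dart, marginal p X {y} d = marginal p X {x} d.symm := fun d => by
      refine Fintype.sum_equiv (Function.Involutive.toPerm _ SimpleGraph.Dart.symm_involutive)
        _ _ fun d' => ?_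
      simp [Agree, X, hxy.symm, p]
    simp only [entropy, hm]
    congr 1
    exact Fintype.sum_equiv (Function.Involutive.toPerm _ SimpleGraph.Dart.symm_involutive)
      _ _ fun d => by simp [p]
  · have hm : ∀ d : G.Dart, marginal p X {x, y} d = (Fintype.card G.Dart : ℝ)⁻¹ := fun d => by
      have : ∀ d', Agree X {x, y} d d' ↔ d = d' := fun d' => by
        simp [Agree, X, hxy.symm, SimpleGraph.Dart.ext_iff, Prod.ext_iff]
      simp [marginal, this, p]
    simp [entropy, hm, p]
  · rw [Nat.card_eq_fintype_card]
    exact entropy_le_log_card hp univ (X x) {x} (by simp) fun ω ω' h => by simpa [Agree] using h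

/-- The invariant of the induction on blocks: the vertices of the blocks `B 0, ..., B i` carry
random vertices of `G`, each of entropy `h`, such that the edges of `H` between these blocks are mapped to
edges of `G` and the joint entropy is large. In the application `2 * h + c` is the entropy of a
random edge of `G`. The variables at the vertices of later blocks are irrelevant. -/
structure IsBlockDistribution {V W Ω : Type*} [DecidableEq V] [Fintype Ω] (G : SimpleGraph W)
    (B P : ℕ → Finset V) (h c : ℝ) (i : ℕ) (p : Ω → ℝ) (X : V → Ω → W) : Prop where
  isDistribution : IsDistribution p
  entropy_singleton : ∀ k ≤ i, ∀ v ∈ B k, entropy p X {v} = h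
  /-- Given its parent set `P k`, the entropy of a block is additive over its vertices; each
  contributes `h + #(P k) * c`, plus the defect `h - entropy (P k) / #(P k)` of independence among
  the variables in `P k`. -/
  le_entropy_parent_union : ∀ k, 1 ≤ k → k ≤ i → ∀ S ⊆ B k,
    entropy p X (P k) + #S * (2 * h + #(P k) * c - entropy p X (P k) / #(P k))
      ≤ entropy p X (P k ∪ S)
  le_entropy : #((range (i + 1)).biUnion B) * h + c * ∑ k ∈ Icc 1 i, #(P k) * #(B k)
    ≤ entropy p X ((range (i + 1)).biUnion B)
  adj : ∀ ω, p ω ≠ 0 → ∀ k, 1 ≤ k → k ≤ i → ∀ x ∈ P k, ∀ y ∈ B k, G.Adj (X x ω) (X y ω)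

namespace IsBlockRepresentation

variable {V : Type u} [DecidableEq V] {H : SimpleGraph V} {m : ℕ} {B P : ℕ → Finset V}
  {W : Type v} {G : SimpleGraph W} {h c : ℝ}

/-- Base of the induction on blocks: a random edge is extended to a star by copies of one of
its ends, and this star to a complete bipartite graph by copies of its centre. -/
lemma exists_isBlockDistribution_one [Finite W] (hB : IsBlockRepresentation H m B P)
    [Nonempty G.Dart] :
    ∃ h c : ℝ, h ≤ Real.log (Nat.card W) ∧ c ≤ 0 ∧ 2 * h + c = Real.log (Nat.card G.Dart) ∧
      ∃ (Ω : Type v) (_ : Fintype Ω) (p : Ω → ℝ) (X : V → Ω → W),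
        IsBlockDistribution G B P h c 1 p X := by
  obtain ⟨x, hx⟩ := hB.nonempty 0 (Nat.zero_le m)
  obtain ⟨y, hy⟩ := hB.nonempty 1 hB.one_le
  have h01 : Disjoint (B 0) (B 1) := hB.disjoint 0 1 (Nat.zero_le m) hB.one_le zero_ne_one
  have hy0 : y ∉ B 0 := disjoint_right.1 h01 hy
  have hxy : x ≠ y := fun h => hy0 (h ▸ hx)
  obtain ⟨Ω₀, _, p₀, X₀, hp₀, hyx, hE, hlog, hadj₀⟩ :=
    exists_edge_distribution (V := V) G hxy
  set h := entropy p₀ X₀ {x}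
  have hsub : entropy p₀ X₀ {x, y} ≤ 2 * h := by
    have := entropy_le_sum (X := X₀) hp₀ {x, y}
    rw [sum_pair hxy] at this
    linarith
  refine ⟨h, entropy p₀ X₀ {x, y} - 2 * h, hlog, by linarith, by rw [← hE]; ring, ?_⟩
  have hyT : y ∉ (B 0).erase x := fun h => hy0 (mem_of_mem_erase h)
  obtain ⟨Ω₁, _, p₁, X₁, hp₁, hS₁, hv₁, hext₁, hsupp₁⟩ :=
    exists_copies hp₀ (X := X₀) (P := {y}) (j := x) ((B 0).erase x) (by simpa using hyT) (by simp)
  have hstar : entropy p₁ X₁ (insert y (B 0))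
      = entropy p₀ X₀ {x, y} + ((#(B 0) : ℝ) - 1) * (entropy p₀ X₀ {x, y} - h) := by
    have hd : Disjoint ({x, y} : Finset V) ((B 0).erase x) :=
      disjoint_insert_left.2 ⟨by simp, by simpa using hyT⟩
    have := hext₁ {x, y} _ (by simp) hd subset_rfl
    rw [card_erase_of_mem hx, Nat.cast_pred (card_pos.2 ⟨x, hx⟩), hyx] at this
    rw [← this]
    congr 1
    ext u
    by_cases hux : u = x
    · simp [hux, hx]
    · simp [hux]
  have hv₁' : ∀ v ∈ B 0, entropy p₁ X₁ {v} = h := by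
    intro v hv
    by_cases hvx : v = x
    · rw [hvx, hS₁ _ (by simp)]
    · exact hv₁ v (mem_erase.2 ⟨hvx, hv⟩)
  have hy₁ : entropy p₁ X₁ {y} = h := by rw [hS₁ _ (by simpa using hyT), hyx]
  have hadj₁ : ∀ ω, p₁ ω ≠ 0 → ∀ u ∈ B 0, G.Adj (X₁ u ω) (X₁ y ω) := by
    intro ω hω u hu
    obtain ⟨⟨η, -, hη⟩, hT⟩ := hsupp₁ ω hω
    by_cases hux : u = x
    · rw [hux, hη x (by simp), hη y hyT]
      exact hadj₀ η
    · obtain ⟨ζ, -, hζ, hζu⟩ := hT u (mem_erase.2 ⟨hux, hu⟩)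
      rw [hζu, hζ y (by simp)]
      exact hadj₀ ζ
  obtain ⟨Ω₂, _, p₂, X₂, hp₂, hS₂, hv₂, hext₂, hsupp₂⟩ :=
    exists_copies hp₁ (X := X₁) (P := B 0) (j := y) ((B 1).erase y)
      (h01.mono_right (erase_subset _ _)) (by simp)
  have hdisj : Disjoint (B 0) ((B 1).erase y) := h01.mono_right (erase_subset _ _)
  have hv₂' : ∀ v ∈ B 0, entropy p₂ X₂ {v} = h := fun v hv => by
    rw [hS₂ _ (by simpa using fun _ => disjoint_left.1 h01 hv), hv₁' v hv]
  have hv₂'' : ∀ v ∈ B 1, entropy p₂ X₂ {v} = h := fun v hv => by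
    by_cases hvy : v = y
    · rw [hvy, hS₂ _ (by simp), hy₁]
    · rw [hv₂ v (mem_erase.2 ⟨hvy, hv⟩), hy₁]
  have hle : entropy p₂ X₂ (B 0) ≤ #(B 0) * h := by
    refine (entropy_le_sum hp₂ (B 0)).trans_eq ?_
    rw [sum_congr rfl hv₂', sum_const, nsmul_eq_mul]
  have hunion : ∀ S ⊆ B 1, entropy p₂ X₂ (B 0 ∪ S) = entropy p₂ X₂ (B 0)
      + #S * (entropy p₁ X₁ (insert y (B 0)) - entropy p₂ X₂ (B 0)) := by
    intro S hS
    by_cases hyS : y ∈ S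
    · have := hext₂ (insert y (B 0)) (S.erase y) (subset_insert _ _)
        (disjoint_insert_left.2 ⟨by simp, hdisj⟩) (erase_subset_erase _ hS)
      rw [card_erase_of_mem hyS, Nat.cast_pred (card_pos.2 ⟨y, hyS⟩), insert_union, ← union_insert,
        insert_erase hyS, ← hS₂ (B 0) hdisj] at this
      rw [this]
      ring
    · rw [hext₂ (B 0) S subset_rfl hdisj (subset_erase.2 ⟨hS, hyS⟩), hS₂ (B 0) hdisj]
  rw [hstar] at hunion
  have ha : (1 : ℝ) ≤ #(B 0) := by exact_mod_cast card_pos.2 ⟨x, hx⟩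
  have hb : (1 : ℝ) ≤ #(B 1) := by exact_mod_cast card_pos.2 ⟨y, hy⟩
  refine ⟨Ω₂, inferInstance, p₂, X₂, hp₂, ?_, ?_, ?_, ?_⟩
  · intro k hk v hv
    interval_cases k
    exacts [hv₂' v hv, hv₂'' v hv]
  · intro k hk1 hk S hS
    obtain rfl : k = 1 := le_antisymm hk hk1
    rw [hB.parent_one, hunion S hS]
    refine add_le_add le_rfl (mul_le_mul_of_nonneg_left ?_ (Nat.cast_nonneg _))
    have hdiv : entropy p₂ X₂ (B 0) / #(B 0) ≤ h := by
      rw [div_le_iff₀ (by linarith)]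
      linarith
    have hmul : entropy p₂ X₂ (B 0) = entropy p₂ X₂ (B 0) / #(B 0) * #(B 0) := by field_simp
    nlinarith [mul_nonneg (sub_nonneg.2 ha) (sub_nonneg.2 hdiv)]
  · have hU : (range (1 + 1)).biUnion B = B 0 ∪ B 1 := by
      ext; simp [Nat.le_one_iff_eq_zero_or_eq_one, or_and_right, exists_or]
    rw [hU, hunion _ subset_rfl, card_union_of_disjoint h01]
    simp only [Icc_self, sum_singleton, hB.parent_one]
    push_cast
    nlinarith [mul_nonneg (sub_nonneg.2 hb) (sub_nonneg.2 hle)]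
  · intro ω hω k hk1 hk u hu z hz
    obtain rfl : k = 1 := le_antisymm hk hk1
    rw [hB.parent_one] at hu
    obtain ⟨⟨η, hη0, hη⟩, hT⟩ := hsupp₂ ω hω
    by_cases hzy : z = y
    · rw [hzy, hη u (disjoint_left.1 hdisj hu), hη y (by simp)]
      exact hadj₁ η hη0 u hu
    · obtain ⟨ζ, hζ0, hζ, hζz⟩ := hT z (mem_erase.2 ⟨hzy, hz⟩)
      rw [hζz, hζ u hu]
      exact hadj₁ ζ hζ0 u hu

/-- The estimate behind the induction step, which rests on the condition `k ≤ l`: here `k` and `l`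
are the sizes of the parent sets of the parent block and of the new block, `A` and `A'` are the
entropies of these sets, and `κ` is the conditional entropy of a new vertex. -/
lemma le_conditional_entropy {k l h c A A' κ : ℝ} (hk : 0 < k) (hkl : k ≤ l) (hA : A ≤ k * h)
    (hA' : A' ≤ l * h) (hκ : A + l * (2 * h + k * c - A / k) - A' ≤ k * κ) :
    2 * h + l * c - A' / l ≤ κ := by
  have hl := hk.trans_le hkl
  have h1 : A / k ≤ h := by rw [div_le_iff₀ hk]; linarith
  have h2 : A' / l ≤ h := by rw [div_le_iff₀ hl]; linarith
  have h3 : A = k * (A / k) := by field_simp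
  have h4 : A' = l * (A' / l) := by field_simp
  refine le_of_mul_le_mul_left ?_ hk
  nlinarith [mul_nonneg (sub_nonneg.2 hkl) (add_nonneg (sub_nonneg.2 h1) (sub_nonneg.2 h2))]

/-- Induction step: the vertices of a new block `B (i + 1)` with parent block `B g` are copies,
given the parent set `P (i + 1)`, of the vertex of `P g` with the largest conditional entropy. -/
lemma exists_isBlockDistribution_succ (hB : IsBlockRepresentation H m B P) {i : ℕ} (hi1 : 1 ≤ i)
    (hi : i + 1 ≤ m) {Ω : Type v} [Fintype Ω] {p : Ω → ℝ} {X : V → Ω → W}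
    (hX : IsBlockDistribution G B P h c i p X) :
    ∃ (Ω' : Type v) (_ : Fintype Ω') (p' : Ω' → ℝ) (X' : V → Ω' → W),
      IsBlockDistribution G B P h c (i + 1) p' X' := by
  obtain ⟨g, hg1, hgi, hPg, hcard⟩ := hB.parent (i + 1) (by omega) hi
  have hgi' : g ≤ i := Nat.le_of_lt_succ hgi
  have hgm : g ≤ m := by omega
  obtain ⟨g', hg', hPg'⟩ := hB.exists_parent_subset hg1 hgm
  obtain ⟨j, hj, hmax⟩ := exists_max_image (P g)
    (fun v => entropy p X (insert v (P (i + 1)))) (card_pos.1 (hB.card_parent_pos hg1 hgm))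
  have hp := hX.isDistribution
  have hle : ∀ {k : ℕ}, k ≤ i → ∀ S ⊆ B k, entropy p X S ≤ #S * h := fun hk S hS => by
    refine (entropy_le_sum hp S).trans_eq ?_
    rw [sum_congr rfl fun v hv => hX.entropy_singleton _ hk v (hS hv), sum_const, nsmul_eq_mul]
  set κ := entropy p X (insert j (P (i + 1))) - entropy p X (P (i + 1))
  have hκle : 2 * h + #(P (i + 1)) * c - entropy p X (P (i + 1)) / #(P (i + 1)) ≤ κ := by
    refine le_conditional_entropy (by exact_mod_cast hB.card_parent_pos hg1 hgm)
      (by exact_mod_cast hcard) (hle (by omega) _ hPg') (hle hgi' _ hPg) ?_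
    calc _ ≤ entropy p X (P g ∪ P (i + 1)) - entropy p X (P (i + 1)) :=
          sub_le_sub_right (hX.le_entropy_parent_union g hg1 hgi' _ hPg) _
      _ ≤ ∑ v ∈ P g, (entropy p X (insert v (P (i + 1))) - entropy p X (P (i + 1))) := by
          rw [union_comm]
          exact entropy_union_sub_le_sum hp _ _
      _ ≤ ∑ v ∈ P g, κ := sum_le_sum fun v hv => sub_le_sub_right (hmax v hv) _
      _ = #(P g) * κ := by rw [sum_const, nsmul_eq_mul]
  have hPnew : Disjoint (P (i + 1)) (B (i + 1)) := hB.disjoint_parent (by omega) le_rfl hi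
  have hold : ∀ k ≤ i, Disjoint (B k) (B (i + 1)) := fun k hk =>
    hB.disjoint k (i + 1) (by omega) hi (by omega)
  have hjB : j ∈ B g' := hPg' hj
  obtain ⟨Ω', _, p', X', hp', hS', hv', hext', hsupp'⟩ :=
    exists_copies hp (X := X) (P := P (i + 1)) (j := j) (B (i + 1)) hPnew
      (disjoint_left.1 (hold g' (by omega)) hjB)
  have hPold : ∀ k, 1 ≤ k → k ≤ i + 1 → entropy p' X' (P k) = entropy p X (P k) :=
    fun k hk1 hk => hS' _ (hB.disjoint_parent hk1 hk hi)
  refine ⟨Ω', inferInstance, p', X', hp', ?_, ?_, ?_, ?_⟩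
  · intro k hk v hv
    rcases hk.lt_or_eq with hk | rfl
    · have hk := Nat.le_of_lt_succ hk
      rw [hS' _ (by simpa using disjoint_left.1 (hold k hk) hv), hX.entropy_singleton k hk v hv]
    · rw [hv' v hv, hX.entropy_singleton g' (by omega) j hjB]
  · intro k hk1 hk S hS
    rw [hPold k hk1 hk]
    rcases hk.lt_or_eq with hk | rfl
    · have hk := Nat.le_of_lt_succ hk
      rw [hS' _ (disjoint_union_left.2
        ⟨hB.disjoint_parent hk1 (by omega) hi, (hold k hk).mono_left hS⟩)]
      exact hX.le_entropy_parent_union k hk1 hk S hS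
    · rw [hext' _ S subset_rfl hPnew hS]
      gcongr
  · have hU : (range (i + 1 + 1)).biUnion B = (range (i + 1)).biUnion B ∪ B (i + 1) := by
      rw [range_add_one, biUnion_insert, union_comm]
    have hUd : Disjoint ((range (i + 1)).biUnion B) (B (i + 1)) :=
      (disjoint_biUnion_left _ _ _).2 fun k hk => hold k (Nat.le_of_lt_succ (mem_range.1 hk))
    have hPU : P (i + 1) ⊆ (range (i + 1)).biUnion B :=
      hPg.trans (subset_biUnion_of_mem B (mem_range.2 hgi))
    rw [hU, hext' _ _ hPU hUd subset_rfl, card_union_of_disjoint hUd, sum_Icc_succ_top (by omega)]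
    have hdiv : entropy p X (P (i + 1)) / #(P (i + 1)) ≤ h := by
      have hpos : (0 : ℝ) < #(P (i + 1)) := by exact_mod_cast hB.card_parent_pos (by omega) hi
      rw [div_le_iff₀ hpos, mul_comm]
      exact hle hgi' _ hPg
    have hκ' : h + #(P (i + 1)) * c ≤ κ := by linarith
    have := mul_le_mul_of_nonneg_left hκ' (Nat.cast_nonneg (α := ℝ) #(B (i + 1)))
    have := hX.le_entropy
    push_cast at this ⊢
    linarith
  · intro ω hω k hk1 hk x hx y hy
    obtain ⟨⟨η, hη0, hη⟩, hT⟩ := hsupp' ω hω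
    rcases hk.lt_or_eq with hk | rfl
    · have hk := Nat.le_of_lt_succ hk
      rw [hη x (disjoint_left.1 (hB.disjoint_parent hk1 (by omega) hi) hx),
        hη y (disjoint_left.1 (hold k hk) hy)]
      exact hX.adj η hη0 k hk1 hk x hx y hy
    -- The copied vertex `j` lies in `P g` and `x` lies in `B g`, so they are adjacent.
    · obtain ⟨ζ, hζ0, hζ, hζy⟩ := hT y hy
      rw [hζy, hζ x hx]
      exact (hX.adj ζ hζ0 g hg1 hgi' j hj x (hPg hx)).symm

end IsBlockRepresentation

lemma card_hom_completeGraph_le {W : Type v} [Finite W] (G : SimpleGraph W) :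
    Nat.card (SimpleGraph.completeGraph (Fin 2) →g G) ≤ Nat.card G.Dart := by
  classical
  have := Fintype.ofFinite W
  refine Nat.card_le_card_of_injective
    (fun f => (⟨(f 0, f 1), f.map_rel (by simp)⟩ : G.Dart)) fun f f' h => ?_
  simp only [SimpleGraph.Dart.mk.injEq, Prod.mk.injEq] at h
  ext i
  fin_cases i
  exacts [h.1, h.2]

theorem IsBlockRepresentation.satisfiesSidorenko {V : Type u} [Finite V] {H : SimpleGraph V} {m : ℕ}
    {B P : ℕ → Finset V} (hB : IsBlockRepresentation H m B P) :
    SatisfiesSidorenko.{u, v} H := by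
  classical
  intro W _ _ G
  have := Fintype.ofFinite V
  have := Fintype.ofFinite W
  set n := Nat.card V
  set e := Nat.card H.edgeSet
  have hne : n ≤ 2 * e := hB.card_le_two_mul_card_edgeSet
  have hV : 0 < n := Nat.card_pos_iff.2 ⟨(hB.nonempty 0 (Nat.zero_le m)).to_type, inferInstance⟩
  have hW : 0 < Nat.card W := Nat.card_pos
  rcases isEmpty_or_nonempty G.Dart with hD | hD
  · have h0 : Nat.card (SimpleGraph.completeGraph (Fin 2) →g G) = 0 := by
      simpa using card_hom_completeGraph_le G
    rw [homDensity, h0, Nat.cast_zero, zero_div, zero_pow (by omega)]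
    unfold homDensity
    positivity
  have hD0 : 0 < Nat.card G.Dart := Nat.card_pos
  obtain ⟨h, c, hh, hc, hhc, hstate⟩ := hB.exists_isBlockDistribution_one (G := G)
  have hall : ∀ i, 1 ≤ i → i ≤ m → ∃ (Ω : Type v) (_ : Fintype Ω) (p : Ω → ℝ) (X : V → Ω → W),
      IsBlockDistribution G B P h c i p X := by
    intro i hi
    induction i, hi using Nat.le_induction with
    | base => exact fun _ => hstate
    | succ i hi1 ih =>
      intro hi
      obtain ⟨Ω, _, p, X, hX⟩ := ih (by omega)
      exact hB.exists_isBlockDistribution_succ hi1 hi hX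
  obtain ⟨Ω, _, p, X, hX⟩ := hall m hB.one_le le_rfl
  have hU : (range (m + 1)).biUnion B = univ := by
    ext x
    simpa [Nat.lt_succ_iff] using hB.cover x
  have hhom : ∀ ω, p ω ≠ 0 → ∀ x y, H.Adj x y → G.Adj (X x ω) (X y ω) := by
    intro ω hω x y hxy
    obtain ⟨k, hk1, hk, ⟨hx, hy⟩ | ⟨hy, hx⟩⟩ := (hB.adj_iff x y).1 hxy
    · exact hX.adj ω hω k hk1 hk x hx y hy
    · exact (hX.adj ω hω k hk1 hk y hy x hx).symm
  have hN : #(univ.map ⟨fun f : H →g G => (f : V → W), DFunLike.coe_injective⟩)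
      = Nat.card (H →g G) := by rw [card_map, card_univ, Nat.card_eq_fintype_card]
  have hupper := entropy_le_log_card (X := X) hX.isDistribution
    (univ.map ⟨fun f : H →g G => (f : V → W), DFunLike.coe_injective⟩) (fun ω v => X v ω) univ
    (fun ω hω => mem_map.2 ⟨⟨_, fun {a b} => hhom ω hω a b⟩, mem_univ _, rfl⟩)
    fun ω ω' hω v _ => congrFun hω v
  rw [hN] at hupper
  have hlower := hX.le_entropy
  rw [hU, card_univ, ← Nat.card_eq_fintype_card] at hlower
  have hsum : (∑ k ∈ Icc 1 m, #(P k) * #(B k) : ℕ) ≤ (e : ℝ) := by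
    exact_mod_cast hB.sum_card_mul_card_le
  have hlog : (e : ℝ) * Real.log (Nat.card G.Dart)
      ≤ Real.log (Nat.card (H →g G)) + (2 * e - n : ℝ) * Real.log (Nat.card W) := by
    have h1 := mul_le_mul_of_nonpos_left hsum hc
    have h2 : (0 : ℝ) ≤ 2 * e - n := by
      have : (n : ℝ) ≤ 2 * e := by exact_mod_cast hne
      linarith
    have h3 := mul_le_mul_of_nonneg_left hh h2
    push_cast at h1
    rw [← hhc]
    nlinarith
  have hH0 : 0 < Nat.card (H →g G) := by
    obtain ⟨ω, -, hω⟩ :=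
      exists_ne_zero_of_sum_ne_zero (hX.isDistribution.sum_eq_one.trans_ne one_ne_zero)
    have : Nonempty (H →g G) := ⟨⟨fun v => X v ω, fun {a b} => hhom ω hω a b⟩⟩
    exact Nat.card_pos
  have hpow : (Nat.card G.Dart : ℝ) ^ e * (Nat.card W : ℝ) ^ n
      ≤ Nat.card (H →g G) * ((Nat.card W : ℝ) ^ 2) ^ e := by
    have hW' : (0 : ℝ) < Nat.card W := by exact_mod_cast hW
    have hD' : (0 : ℝ) < Nat.card G.Dart := by exact_mod_cast hD0
    have hH' : (0 : ℝ) < Nat.card (H →g G) := by exact_mod_cast hH0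
    rw [← Real.log_le_log_iff (by positivity) (by positivity),
      Real.log_mul (by positivity) (by positivity), Real.log_mul (by positivity) (by positivity)]
    simp only [Real.log_pow]
    push_cast
    linarith
  unfold homDensity
  rw [Nat.card_eq_fintype_card (α := Fin 2), Fintype.card_fin, div_pow,
    div_le_div_iff₀ (by positivity) (by positivity)]
  refine le_trans ?_ hpow
  gcongr
  exact card_hom_completeGraph_le G

/-! ### A vertex complete to the other part -/

/-- The blocks are the dominating vertex `a`, the part `Aᶜ`, and the other vertices of `A`, one by
one, with their neighbourhoods as parent sets. -/
lemma HasVertexCompleteToOtherPart.isTreeDegenerate {V : Type u} [Finite V] {H : SimpleGraph V}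
    (hH : HasVertexCompleteToOtherPart H) (hiso : ∀ x, ∃ y, H.Adj x y) : IsTreeDegenerate H := by
  classical
  have := Fintype.ofFinite V
  obtain ⟨A, hA, a, ha, hadj⟩ := hH
  have hAA : ∀ {x y}, H.Adj x y → x ∈ A → y ∉ A := fun h hx =>
    (hA.mem_of_adj h).elim (fun h' => h'.2) fun h' => (h'.1 hx).elim
  have hAc : ∀ {x y}, H.Adj x y → x ∉ A → y ∈ A := fun h hx =>
    (hA.mem_of_adj h).elim (fun h' => (hx h'.1).elim) fun h' => h'.2
  let e := Fintype.equivFin {x : V // x ∈ A ∧ x ≠ a}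
  let k := Fintype.card {x : V // x ∈ A ∧ x ≠ a}
  let v : ℕ → V := fun i => if hi : i < k then (e.symm ⟨i, hi⟩ : V) else a
  have hv : ∀ {i}, i < k → v i ∈ A ∧ v i ≠ a := fun {i} hi => by
    simpa only [v, dif_pos hi] using (e.symm ⟨i, hi⟩).2
  have hvinj : ∀ {i j}, i < k → j < k → v i = v j → i = j := fun {i j} hi hj h => by
    simpa [v, hi, hj, Subtype.coe_inj] using h
  have hvsurj : ∀ x ∈ A, x ≠ a → ∃ i < k, v i = x := fun x hx hxa =>
    ⟨e ⟨x, hx, hxa⟩, (e _).2, by simp [v, k]⟩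
  let B : ℕ → Finset V
    | 0 => {a}
    | 1 => Finset.univ.filter (· ∉ A)
    | i + 2 => {v i}
  let P : ℕ → Finset V
    | 0 => ∅
    | 1 => {a}
    | i + 2 => Finset.univ.filter (H.Adj (v i))
  have hB : ∀ {x i j}, i ≤ k + 1 → j ≤ k + 1 → x ∈ B i → x ∈ B j → i = j := by
    intro x i j hi hj hxi hxj
    match i, j, hxi, hxj with
    | 0, 0, _, _ => rfl
    | 0, 1, hxi, hxj =>
      simp only [B, Finset.mem_singleton, Finset.mem_filter] at hxi hxj
      exact (hxj.2 (hxi ▸ ha)).elim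
    | 0, j + 2, hxi, hxj =>
      simp only [B, Finset.mem_singleton] at hxi hxj
      exact ((hv (by omega : j < k)).2 (hxj.symm.trans hxi)).elim
    | 1, 0, hxi, hxj =>
      simp only [B, Finset.mem_singleton, Finset.mem_filter] at hxi hxj
      exact (hxi.2 (hxj ▸ ha)).elim
    | 1, 1, _, _ => rfl
    | 1, j + 2, hxi, hxj =>
      simp only [B, Finset.mem_singleton, Finset.mem_filter] at hxi hxj
      exact (hxi.2 (hxj ▸ (hv (by omega : j < k)).1)).elim
    | i + 2, 0, hxi, hxj =>
      simp only [B, Finset.mem_singleton] at hxi hxj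
      exact ((hv (by omega : i < k)).2 (hxi.symm.trans hxj)).elim
    | i + 2, 1, hxi, hxj =>
      simp only [B, Finset.mem_singleton, Finset.mem_filter] at hxi hxj
      exact (hxj.2 (hxi ▸ (hv (by omega : i < k)).1)).elim
    | i + 2, j + 2, hxi, hxj =>
      simp only [B, Finset.mem_singleton] at hxi hxj
      rw [hvinj (by omega) (by omega) (hxi.symm.trans hxj)]
  -- One direction of the edge condition, for an edge that starts in `A`.
  have hedge : ∀ {x y}, H.Adj x y → x ∈ A →
      ∃ i, 1 ≤ i ∧ i ≤ k + 1 ∧ ((x ∈ P i ∧ y ∈ B i) ∨ (y ∈ P i ∧ x ∈ B i)) := by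
    intro x y hxy hx
    by_cases hxa : x = a
    · exact ⟨1, le_rfl, by omega, Or.inl ⟨by simp [P, hxa], by simp [B, hAA hxy hx]⟩⟩
    · obtain ⟨i, hi, rfl⟩ := hvsurj x hx hxa
      exact ⟨i + 2, by omega, by omega, Or.inr ⟨by simp [P, hxy], by simp [B]⟩⟩
  have hedge' : ∀ {x y i}, 1 ≤ i → x ∈ P i → y ∈ B i → H.Adj x y := by
    intro x y i hi hx hy
    match i, hi, hx, hy with
    | 1, _, hx, hy =>
      simp only [P, B, Finset.mem_singleton, Finset.mem_filter] at hx hy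
      exact hx ▸ hadj y hy.2
    | i + 2, _, hx, hy =>
      simp only [P, B, Finset.mem_singleton, Finset.mem_filter] at hx hy
      exact hy ▸ hx.2.symm
  refine ⟨hA.isBipartite, k + 1, B, P, by omega, ?_, ?_, ?_, rfl, ?_, ?_⟩
  · intro i hi
    match i with
    | 0 => exact Finset.singleton_nonempty a
    | 1 =>
      obtain ⟨y, hy⟩ := hiso a
      exact ⟨y, by simp [B, hAA hy ha]⟩
    | i + 2 => exact Finset.singleton_nonempty _
  · exact fun i j hi hj hij => Finset.disjoint_left.2 fun x hxi hxj => hij (hB hi hj hxi hxj)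
  · intro x
    by_cases hx : x ∈ A
    · by_cases hxa : x = a
      · exact ⟨0, by omega, by simp [B, hxa]⟩
      · obtain ⟨i, hi, rfl⟩ := hvsurj x hx hxa
        exact ⟨i + 2, by omega, by simp [B]⟩
    · exact ⟨1, by omega, by simp [B, hx]⟩
  · intro i hi2 hi
    match i, hi2 with
    | i + 2, _ =>
      refine ⟨1, le_rfl, by omega, fun y hy => ?_, ?_⟩
      · simp only [P, Finset.mem_filter] at hy
        simpa [B] using hAA hy.2 (hv (by omega)).1
      · obtain ⟨y, hy⟩ := hiso (v i)
        exact (Finset.card_singleton a).trans_le (Finset.card_pos.2 ⟨y, by simp [P, hy]⟩)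
  · refine fun x y => ⟨fun hxy => ?_, ?_⟩
    · by_cases hx : x ∈ A
      · exact hedge hxy hx
      · obtain ⟨i, h1, hi, h⟩ := hedge hxy.symm (hAc hxy hx)
        exact ⟨i, h1, hi, h.symm⟩
    · rintro ⟨i, h1, -, ⟨hx, hy⟩ | ⟨hy, hx⟩⟩
      exacts [hedge' h1 hx hy, (hedge' h1 hy hx).symm]

/-- Isolated vertices contribute a factor `1` to the homomorphism density. -/
lemma SatisfiesSidorenko.of_induce_support {V : Type u} [Finite V] {H : SimpleGraph V}
    (hH : SatisfiesSidorenko.{u, v} (H.induce H.support)) : SatisfiesSidorenko.{u, v} H := by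
  classical
  intro W _ _ G
  have hcard : Nat.card V = Nat.card H.support + Nat.card (H.supportᶜ : Set V) := by
    rw [Nat.card_coe_set_eq, Nat.card_coe_set_eq, Set.ncard_add_ncard_compl]
  have hedge : Nat.card (H.induce H.support).edgeSet = Nat.card H.edgeSet := by
    have := Fintype.ofFinite V
    simp only [Nat.card_eq_fintype_card, ← SimpleGraph.edgeFinset_card]
    convert SimpleGraph.card_edgeFinset_induce_support (G := H)
  have hhom : Nat.card (H.induce H.support →g G) * Nat.card W ^ Nat.card (H.supportᶜ : Set V)
      ≤ Nat.card (H →g G) := by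
    rw [← Nat.card_fun, ← Nat.card_prod]
    have : Finite (H →g G) := DFunLike.finite _
    refine Nat.card_le_card_of_injective (fun f : (H.induce H.support →g G) ×
        ((H.supportᶜ : Set V) → W) => (⟨fun x => if hx : x ∈ H.support then f.1 ⟨x, hx⟩
          else f.2 ⟨x, hx⟩, fun {x y} hxy => ?_⟩ : H →g G)) fun f f' h => ?_
    · have hx : x ∈ H.support := ⟨y, hxy⟩
      have hy : y ∈ H.support := ⟨x, hxy.symm⟩
      simpa only [dif_pos hx, dif_pos hy] using
        f.1.map_rel (show (H.induce H.support).Adj ⟨x, hx⟩ ⟨y, hy⟩ from hxy)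
    · have h' := fun x => DFunLike.congr_fun h x
      refine Prod.ext (DFunLike.ext _ _ fun x => ?_) (funext fun x => ?_)
      · have := h' x
        simpa [x.2] using this
      · have := h' x
        have hx : (x : V) ∉ H.support := x.2
        simpa [hx] using this
  have hW : (0 : ℝ) < Nat.card W := by exact_mod_cast Nat.card_pos
  rw [← hedge]
  refine (hH W G).trans ?_
  unfold homDensity
  rw [div_le_div_iff₀ (by positivity) (by positivity), hcard, pow_add, ← mul_assoc, mul_right_comm]
  gcongr
  exact_mod_cast hhom

lemma SatisfiesSidorenko.of_isEmpty {V : Type u} [IsEmpty V] (H : SimpleGraph V) :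
    SatisfiesSidorenko.{u, v} H := by
  intro W _ _ G
  have : IsEmpty H.edgeSet := ⟨fun e => e.1.ind (fun x _ => isEmptyElim x)⟩
  have : Unique (H →g G) :=
    { default := ⟨isEmptyElim, fun {x} => isEmptyElim x⟩
      uniq := fun f => by ext x; exact isEmptyElim x }
  simp [homDensity]

lemma HasVertexCompleteToOtherPart.satisfiesSidorenko {V : Type u} [Finite V] {H : SimpleGraph V}
    (hH : HasVertexCompleteToOtherPart H) : SatisfiesSidorenko.{u, v} H := by
  refine .of_induce_support ?_
  rcases isEmpty_or_nonempty H.support with hs | ⟨⟨x, y, hxy⟩⟩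
  · exact .of_isEmpty _
  obtain ⟨A, hA, a, ha, hadj⟩ := hH
  obtain ⟨b, hb⟩ : ∃ b, b ∉ A :=
    (hA.mem_of_adj hxy).elim (fun h => ⟨y, h.2⟩) fun h => ⟨x, h.1⟩
  have hsupp : HasVertexCompleteToOtherPart (H.induce H.support) := by
    refine ⟨Subtype.val ⁻¹' A, ⟨disjoint_compl_right, fun v w h => hA.mem_of_adj h⟩,
      ⟨a, b, hadj b hb⟩, ha, fun c hc => hadj c hc⟩
  obtain ⟨-, m, B, P, hB⟩ := hsupp.isTreeDegenerate fun x => by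
    obtain ⟨x, y, hxy⟩ := x
    exact ⟨⟨y, x, hxy.symm⟩, hxy⟩
  exact hB.satisfiesSidorenko

end TreeDegenerate

/-- The first part is the Sidorenko property of tree-degenerate graphs. The second part expresses
that this generalizes the case of a vertex complete to the other part: such graphs satisfy
Sidorenko's conjecture, and those without isolated vertices are themselves tree-degenerate. -/
theorem corollary1p8 :
    (∀ (V : Type u) [Finite V] (H : SimpleGraph V),
      TreeDegenerate.IsTreeDegenerate H → TreeDegenerate.SatisfiesSidorenko.{u, v} H) ∧
    (∀ (V : Type u) [Finite V] (H : SimpleGraph V),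
      TreeDegenerate.HasVertexCompleteToOtherPart H →
        TreeDegenerate.SatisfiesSidorenko.{u, v} H ∧
        ((∀ x : V, ∃ y : V, H.Adj x y) → TreeDegenerate.IsTreeDegenerate H)) :=
  ⟨fun _ _ _ ⟨_, _, _, _, hB⟩ => hB.satisfiesSidorenko,
    fun _ _ _ hH => ⟨hH.satisfiesSidorenko, hH.isTreeDegenerate⟩⟩
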